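/- Let $n\ge 2$, $r>1$, $0<v<\frac{r-1}{2}$, $m\ge 0$, $\sigma_w>0$, $\sigma_u>0$ and $N\in\mathbb N$. For $b\in\mathbb R$ let $$A=\begin{bmatrix} r & v & 0 & \cdots & 0\\ 0 & 0 & v & \cdots & 0\\ & & \ddots & \ddots & \\ 0&0&0&\cdots & v\\ 0&0&0&\cdots&0\end{bmatrix}\in\mathbb R^{n\times n},\qquad B(b)=\begin{bmatrix} b\\0\\ \vdots\\0\\ v\end{bmatrix}\in\mathbb R^{n},$$ and let $\mathcal S_1=(A,B(0))$ and $\mathcal S_2=(A,B(m))$. A system $\mathcal S=(A,B)$ evolves by $x_{t+1}=Ax_t+Bu_t+w_t$ with $x_0=0$, where the $w_t$ are i.i.d. $\mathcal N(0,\sigma_w^2 I_n)$ and $w_t$ is independent of $(u_{0:t},x_{0:t})$. A learning-to-stabilize algorithm $\pi$ consists of, for each $t=0,\dots,N-1$, a (measurable) conditional probability distribution $\pi_t(u_{0:t-1},x_{0:t})$ of the input $u_t\in\mathbb R$ given the past inputs $u_{0:t-1}$ and states $x_{0:t}$, together with a map $\pi_N$ from $(u_{0:N-1},x_{0:N})$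 to feedback gains in $\mathbb R^{1\times n}$. Let $\mathbb P^N_{\mathcal S,\pi}$ be the law of $(u_{0:N-1},x_{1:N})$ when $\pi$ is applied to $\mathcal S$, and $\mathbb E_{\mathcal S,\pi}$ the corresponding expectation. Let $\pi$ be any such algorithm with $\mathbb E_{\mathcal S_1,\pi}\left[\|u_t\|_2^2\right]\le\sigma_u^2$ for all $t=0,\dots,N-1$. Then $$\operatorname{KL}\left(\mathbb P^N_{\mathcal S_1,\pi},\mathbb P^N_{\mathcal S_2,\pi}\right)\le\frac{N m^2\sigma_u^2}{2\sigma_w^2}.$$ -/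

import Mathlib

open MeasureTheory ProbabilityTheory InformationTheory
open scoped ENNReal

namespace LearnStab

/-- Vectors in `ℝᵏ` with the Euclidean norm. -/
abbrev Vec (k : ℕ) : Type := EuclideanSpace ℝ (Fin k)

/-- A linear time-invariant system `x_{t+1} = A x_t + B u_t + w_t`,
with state dimension `n` and input dimension `p`. -/
structure LTISystem (n p : ℕ) where
  /-- state matrix -/
  A : Matrix (Fin n) (Fin n) ℝ
  /-- input matrix -/
  B : Matrix (Fin n) (Fin p) ℝ

/-- Histories available at time `t`: the inputs `u_0, …, u_{t-1}` and the states `x_0, …, x_t`. -/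
abbrev History (n p t : ℕ) : Type := (Fin t → Vec p) × (Fin (t + 1) → Vec n)

/-- Input-state trajectories of length `N`: the inputs `u_0, …, u_{N-1}` and the states
`x_1, …, x_N`. -/
abbrev Trajectory (n p N : ℕ) : Type := (Fin N → Vec p) × (Fin N → Vec n)

/-- A learning-to-stabilize algorithm with `N` exploration steps: for each `t < N` a conditional
probability distribution of the input `u_t` given the history `u_{0:t-1}, x_{0:t}`, and at the end
a state-feedback gain computed from the whole data. -/
structure Algorithm (n p N : ℕ) where
  /-- conditional law of `u_t` given the history up to time `t` -/
  policy : (t : Fin N) → Kernel (History n p t) (Vec p)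
  /-- the conditional laws are probability measures -/
  markov : ∀ t, IsMarkovKernel (policy t)
  /-- the learned gain -/
  gain : History n p N → Matrix (Fin p) (Fin n) ℝ

namespace LTISystem

variable {n p : ℕ}

/-- The state that follows the state `x` under the input `u` and the noise `w`. -/
noncomputable def next (S : LTISystem n p) (x : Vec n) (u : Vec p) (w : Vec n) : Vec n :=
  Matrix.toEuclideanLin S.A x + Matrix.toEuclideanLin S.B u + w

/-- Extend a history by the input `u_t` and the state `x_{t+1}` that `u_t` and the noise `w_t`
produce from `x_t`. -/
noncomputable def extend (S : LTISystem n p) {t : ℕ} (z : (History n p t × Vec p) × Vec n) :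
    History n p (t + 1) :=
  (Fin.snoc (α := fun _ => Vec p) z.1.1.1 z.1.2,
    Fin.snoc (α := fun _ => Vec n) z.1.1.2 (S.next (z.1.1.2 (Fin.last t)) z.1.2 z.2))

/-- Law of the process noise `w_t`: centred Gaussian with covariance `σ² I`. -/
noncomputable def noise (n : ℕ) (σ : ℝ) : Measure (Vec n) :=
  multivariateGaussian 0 (σ ^ 2 • (1 : Matrix (Fin n) (Fin n) ℝ))

/-- Law of the history `u_{0:t-1}, x_{0:t}` when the algorithm `π` runs on the system `S` from
`x_0 = 0` with noise level `σ`: given the history at time `t`, the input `u_t` is drawn from the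
policy of `π`, and then `w_t` is drawn independently of the history and of `u_t`. -/
noncomputable def historyLaw (S : LTISystem n p) (σ : ℝ) {N : ℕ} (π : Algorithm n p N) :
    (t : ℕ) → t ≤ N → Measure (History n p t)
  | 0, _ => Measure.dirac (Fin.elim0, fun _ => 0)
  | t + 1, h =>
    (((S.historyLaw σ π t (Nat.le_of_succ_le h)) ⊗ₘ π.policy ⟨t, h⟩).prod (noise n σ)).map
      S.extend

/-- Law of the trajectory `u_{0:N-1}, x_{1:N}` generated by the algorithm `π` on the system `S`
with noise level `σ`. -/
noncomputable def trajectoryLaw (S : LTISystem n p) (σ : ℝ) {N : ℕ} (π : Algorithm n p N) :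
    Measure (Trajectory n p N) :=
  (S.historyLaw σ π N le_rfl).map fun h => (h.1, Fin.tail h.2)

/-- The second moment of each input `u_t`, `0 ≤ t < N`, generated by `π` on `S` is at most
`σu²`. -/
def InputBound (S : LTISystem n p) (σ : ℝ) {N : ℕ} (π : Algorithm n p N) (σu : ℝ) : Prop :=
  ∀ t : Fin N, ∫⁻ z, ‖z.1 t‖ₑ ^ 2 ∂(S.trajectoryLaw σ π) ≤ ENNReal.ofReal (σu ^ 2)

end LTISystem

/-- The single-input system with `A` having `r` in its upper left corner, `v` on the
superdiagonal and `0` elsewhere, and `B = (b, 0, …, 0, v)ᵀ`; meant for `n ≥ 2`. -/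
def chainSystem (n : ℕ) (r v b : ℝ) : LTISystem n 1 where
  A := Matrix.of fun i j =>
    if i.val = 0 ∧ j.val = 0 then r else if j.val = i.val + 1 then v else 0
  B := Matrix.of fun i _ => if i.val = 0 then b else if i.val + 1 = n then v else 0

end LearnStab

open scoped NNReal RealInnerProductSpace

namespace LearnStab

/-! Given the same history and input, the two systems produce Gaussian next states with equal
covariance whose means differ only by `m u_t` in the first coordinate. The policies agree, so by the
chain rule each step adds `m² E[u_t²] / (2 σ²)` at most, the expectation being under the system with
`b = 0`, where the inputs are bounded. To stay with scalar Gaussians, `noise_eq_map_prod` splits off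
the first noise coordinate. By `map_extend_chainSystem`, one step of either system is then the same
map applied to data that differ only in the mean of that coordinate. Data processing removes the
map, `klDiv_prod_left` the remaining noise, and `klDiv_compProd_gaussianKernel_le` bounds what is
left. -/

/-! ### Divergence between scalar Gaussians with random means -/

/-- The kernel that sends `z` to the real Gaussian law with mean `c z` and variance `s`. -/
noncomputable def gaussianKernel {Z : Type*} [MeasurableSpace Z] (c : Z → ℝ) (hc : Measurable c)
    (s : ℝ≥0) : Kernel Z ℝ where
  toFun z := gaussianReal (c z) s
  measurable' := measurable_gaussianReal.comp (hc.prodMk measurable_const)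

lemma gaussianKernel_apply {Z : Type*} [MeasurableSpace Z] (c : Z → ℝ) (hc : Measurable c)
    (s : ℝ≥0) (z : Z) : gaussianKernel c hc s z = gaussianReal (c z) s := rfl

instance {Z : Type*} [MeasurableSpace Z] (c : Z → ℝ) (hc : Measurable c) (s : ℝ≥0) :
    IsMarkovKernel (gaussianKernel c hc s) :=
  ⟨fun z => by rw [gaussianKernel_apply]; infer_instance⟩

/-- Density of a real Gaussian law with respect to the centred one of the same variance. -/
lemma gaussianReal_eq_withDensity (a : ℝ) {s : ℝ≥0} (hs : s ≠ 0) :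
    gaussianReal a s = (gaussianReal 0 s).withDensity
      fun x => ENNReal.ofReal (Real.exp ((2 * a * x - a ^ 2) / (2 * s))) := by
  rw [gaussianReal_of_var_ne_zero _ hs, gaussianReal_of_var_ne_zero _ hs,
    ← withDensity_mul _ (by fun_prop) (by fun_prop)]
  congr 1
  ext x
  rw [Pi.mul_apply, gaussianPDF, gaussianPDF,
    ← ENNReal.ofReal_mul (gaussianPDFReal_nonneg _ _ _), gaussianPDFReal, gaussianPDFReal,
    mul_assoc (√(2 * Real.pi * s))⁻¹, ← Real.exp_add]
  congr 3
  ring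

/-- The divergence between two joint laws with the same first marginal and Gaussian conditional
laws of means `0` and `c z` is at most the mean of `c² / (2 s)`. -/
lemma klDiv_compProd_gaussianKernel_le {Z : Type*} [MeasurableSpace Z] (ρ : Measure Z)
    [IsProbabilityMeasure ρ] (c : Z → ℝ) (hc : Measurable c) {s : ℝ≥0} (hs : s ≠ 0) :
    klDiv (ρ ⊗ₘ Kernel.const Z (gaussianReal 0 s)) (ρ ⊗ₘ gaussianKernel c hc s) ≤
      ∫⁻ z, ENNReal.ofReal (c z ^ 2 / (2 * s)) ∂ρ := by
  have hs' : (0 : ℝ) < s := by positivity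
  -- If the mean of `c²` is infinite there is nothing to prove; otherwise `c` is square integrable
  -- and so is the log-likelihood ratio integrable.
  by_cases hfin : ∫⁻ z, ENNReal.ofReal (c z ^ 2 / (2 * s)) ∂ρ = ∞
  · rw [hfin]; exact le_top
  have hsq : Integrable (fun z => c z ^ 2 / (2 * s)) ρ :=
    (lintegral_ofReal_ne_top_iff_integrable (by fun_prop)
      (ae_of_all _ fun z => by positivity)).1 hfin
  have hcL2 : MemLp c 2 ρ := by
    refine (memLp_two_iff_integrable_sq hc.aestronglyMeasurable).2 ?_
    refine (hsq.mul_const (2 * s)).congr (ae_of_all _ fun z => ?_)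
    change c z ^ 2 / (2 * s) * (2 * s) = c z ^ 2
    field_simp
  have hcint : Integrable c ρ := hcL2.integrable (by norm_num)
  set F : Z → ℝ → ℝ≥0∞ := fun z x =>
    ENNReal.ofReal (Real.exp ((2 * c z * x - c z ^ 2) / (2 * s))) with hF
  have hFm : Measurable (Function.uncurry F) := by
    simp only [hF, Function.uncurry_def]; fun_prop
  have hκ : gaussianKernel c hc s = (Kernel.const Z (gaussianReal 0 s)).withDensity F := by
    ext1 z
    rw [Kernel.withDensity_apply _ hFm, gaussianKernel_apply, Kernel.const_apply,
      gaussianReal_eq_withDensity _ hs]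
  have : IsSFiniteKernel ((Kernel.const Z (gaussianReal 0 s)).withDensity F) := by
    rw [← hκ]; infer_instance
  have hwd : ρ ⊗ₘ gaussianKernel c hc s =
      (ρ.prod (gaussianReal 0 s)).withDensity (fun p => F p.1 p.2) := by
    simp_rw [hκ]
    rw [Measure.compProd_withDensity hFm, Measure.compProd_const]
  rw [Measure.compProd_const]
  set P := ρ.prod (gaussianReal 0 s) with hP
  have hFm' : Measurable fun p : Z × ℝ => F p.1 p.2 := hFm
  have hF0 : ∀ p : Z × ℝ, F p.1 p.2 ≠ 0 := fun p => by
    simp only [hF, ne_eq, ENNReal.ofReal_eq_zero, not_le]; positivity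
  have hFt : ∀ p : Z × ℝ, F p.1 p.2 ≠ ∞ := fun p => ENNReal.ofReal_ne_top
  have hac : P ≪ ρ ⊗ₘ gaussianKernel c hc s := by
    rw [hwd]
    exact withDensity_absolutelyContinuous' hFm'.aemeasurable (ae_of_all _ hF0)
  have hllr : llr P (ρ ⊗ₘ gaussianKernel c hc s) =ᵐ[P]
      fun p => c p.1 ^ 2 / (2 * s) - c p.1 * p.2 * (1 / s) := by
    have h1 := Measure.rnDeriv_withDensity_right P P hFm'.aemeasurable
      (ae_of_all _ hF0) (ae_of_all _ hFt)
    filter_upwards [h1, Measure.rnDeriv_self P] with p hp hp'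
    rw [llr_def, hwd]
    simp only
    rw [hp, hp', mul_one, ENNReal.toReal_inv, Real.log_inv, hF]
    simp only
    rw [ENNReal.toReal_ofReal (Real.exp_pos _).le, Real.log_exp]
    field_simp
    ring
  have hid : Integrable (fun x : ℝ => x) (gaussianReal 0 s) := IsGaussian.integrable_fun_id
  have hi1 : Integrable (fun p : Z × ℝ => c p.1 ^ 2 / (2 * s)) P := hsq.comp_fst _
  have hi2 : Integrable (fun p : Z × ℝ => c p.1 * p.2 * (1 / s)) P :=
    (hcint.mul_prod hid).mul_const _
  have hint : Integrable (llr P (ρ ⊗ₘ gaussianKernel c hc s)) P :=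
    (hi1.sub hi2).congr hllr.symm
  -- The cross term factors over the product measure and vanishes because the Gaussian is centred.
  -- The total-mass terms of `klDiv` cancel, both laws being probabilities.
  rw [klDiv_of_ac_of_integrable hac hint, integral_congr_ae hllr, integral_sub hi1 hi2,
    integral_mul_const, hP, integral_prod_mul (fun z => c z) (fun x : ℝ => x),
    integral_id_gaussianReal, ← ofReal_integral_eq_lintegral_ofReal hsq
      (ae_of_all _ fun z => by positivity)]
  have h3 : ∫ p : Z × ℝ, c p.1 ^ 2 / (2 * s) ∂(ρ.prod (gaussianReal 0 s)) =
      ∫ z, c z ^ 2 / (2 * s) ∂ρ := by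
    rw [integral_fun_fst (fun z => c z ^ 2 / (2 * (s : ℝ)))]; simp
  rw [h3]
  simp

/-- Taking the product with the same probability measure leaves the divergence unchanged. -/
lemma klDiv_prod_left {X Y : Type*} [MeasurableSpace X] [MeasurableSpace Y] (μ ν : Measure X)
    [IsFiniteMeasure μ] [IsFiniteMeasure ν] (τ : Measure Y) [IsProbabilityMeasure τ] :
    klDiv (μ.prod τ) (ν.prod τ) = klDiv μ ν := by
  rw [← Measure.compProd_const, ← Measure.compProd_const, klDiv_compProd_left]

/-! ### Splitting the noise -/

/-- The noise in the coordinates other than `i`. -/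
noncomputable def residualNoise {n : ℕ} (i : Fin n) (σ : ℝ) : Measure (Vec n) :=
  multivariateGaussian 0 (Matrix.diagonal fun j => if j = i then 0 else σ ^ 2)

instance {n : ℕ} (i : Fin n) (σ : ℝ) : IsProbabilityMeasure (residualNoise i σ) := by
  unfold residualNoise; infer_instance

instance {n : ℕ} (σ : ℝ) : IsProbabilityMeasure (LTISystem.noise n σ) := by
  unfold LTISystem.noise; infer_instance

/-- The noise splits into its `i`-th coordinate and an independent remainder. -/
lemma noise_eq_map_prod {n : ℕ} (i : Fin n) (σ : ℝ) :
    LTISystem.noise n σ = ((gaussianReal 0 (σ ^ 2).toNNReal).prod (residualNoise i σ)).map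
      fun p => p.1 • EuclideanSpace.single i (1 : ℝ) + p.2 := by
  have hcomp : ((gaussianReal 0 (σ ^ 2).toNNReal).prod (residualNoise i σ)).map
      (fun p => p.1 • EuclideanSpace.single i (1 : ℝ) + p.2) =
      ((gaussianReal 0 (σ ^ 2).toNNReal).map
        (fun g : ℝ => g • EuclideanSpace.single i (1 : ℝ))) ∗ residualNoise i σ := by
    conv_rhs => rw [← Measure.map_id (μ := residualNoise i σ)]
    rw [Measure.conv, Measure.map_prod_map _ _ (by fun_prop) (by fun_prop),
      Measure.map_map (by fun_prop) (by fun_prop)]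
    rfl
  rw [hcomp]
  have : IsProbabilityMeasure ((gaussianReal 0 (σ ^ 2).toNNReal).map
        (fun g : ℝ => g • EuclideanSpace.single i (1 : ℝ))) :=
    Measure.isProbabilityMeasure_map (by fun_prop)
  -- The remainder has singular covariance, hence no density, so characteristic functions are
  -- compared.
  apply Measure.ext_of_charFun
  ext t
  have h1 : charFun ((gaussianReal 0 (σ ^ 2).toNNReal).map
      (fun g : ℝ => g • EuclideanSpace.single i (1 : ℝ))) t =
      charFun (gaussianReal 0 (σ ^ 2).toNNReal) (t i) := by
    rw [charFun_apply, charFun_apply, integral_map (by fun_prop) (by fun_prop)]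
    congr 1
    ext g
    simp [inner_smul_left, EuclideanSpace.inner_single_left, mul_comm]
  have hpsd1 : (σ ^ 2 • (1 : Matrix (Fin n) (Fin n) ℝ)).PosSemidef :=
    Matrix.PosSemidef.one.smul (sq_nonneg σ)
  have hpsd2 : (Matrix.diagonal fun j : Fin n => if j = i then 0 else σ ^ 2).PosSemidef :=
    Matrix.PosSemidef.diagonal fun j => by
      change (0 : ℝ) ≤ if j = i then 0 else σ ^ 2
      split_ifs <;> positivity
  rw [charFun_conv, h1, charFun_gaussianReal, LTISystem.noise, residualNoise,
    charFun_multivariateGaussian hpsd1, charFun_multivariateGaussian hpsd2, ← Complex.exp_add]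
  congr 1
  have hq : (t.ofLp ⬝ᵥ (σ ^ 2 • (1 : Matrix (Fin n) (Fin n) ℝ)).mulVec t.ofLp) =
      σ ^ 2 * t i ^ 2 + (t.ofLp ⬝ᵥ
        (Matrix.diagonal fun j : Fin n => if j = i then 0 else σ ^ 2).mulVec t.ofLp) := by
    simp only [Matrix.smul_mulVec, Matrix.one_mulVec, dotProduct, Matrix.mulVec_diagonal,
      Pi.smul_apply, smul_eq_mul]
    rw [← Finset.add_sum_erase _ _ (Finset.mem_univ i),
      ← Finset.add_sum_erase _ (fun j => t j * ((if j = i then 0 else σ ^ 2) * t j))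
        (Finset.mem_univ i)]
    rw [Finset.sum_congr rfl (g := fun j => t j * ((if j = i then 0 else σ ^ 2) * t j))
      (fun j hj => by rw [if_neg (Finset.ne_of_mem_erase hj)])]
    simp
    ring
  rw [hq, Real.coe_toNNReal _ (sq_nonneg σ)]
  push_cast
  simp
  ring

/-! ### Measurability and input marginals of histories -/

namespace LTISystem

variable {n p : ℕ}

lemma measurable_next (S : LTISystem n p) :
    Measurable fun z : (Vec n × Vec p) × Vec n => S.next z.1.1 z.1.2 z.2 := by
  have hA := (LinearMap.continuous_of_finiteDimensional (Matrix.toEuclideanLin S.A)).measurable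
  have hB := (LinearMap.continuous_of_finiteDimensional (Matrix.toEuclideanLin S.B)).measurable
  exact ((hA.comp (measurable_fst.comp measurable_fst)).add
    (hB.comp (measurable_snd.comp measurable_fst))).add measurable_snd

lemma measurable_finSnoc {X Y : Type*} [MeasurableSpace X] [MeasurableSpace Y] {t : ℕ}
    {f : Y → Fin t → X} {g : Y → X} (hf : Measurable f) (hg : Measurable g) :
    Measurable fun y => (Fin.snoc (α := fun _ => X) (f y) (g y) : Fin (t + 1) → X) := by
  refine measurable_pi_iff.2 fun j => ?_
  induction j using Fin.lastCases with
  | last => simpa using hg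
  | cast j => simpa [Function.comp_def] using (measurable_pi_apply j).comp hf

lemma measurable_extend (S : LTISystem n p) {t : ℕ} : Measurable (S.extend (t := t)) := by
  unfold extend
  refine (measurable_finSnoc (by fun_prop) (by fun_prop)).prodMk
    (measurable_finSnoc (by fun_prop) ?_)
  exact S.measurable_next.comp (f := fun z : (History n p t × Vec p) × Vec n =>
    ((z.1.1.2 (Fin.last t), z.1.2), z.2)) (by fun_prop)

instance isProbabilityMeasure_historyLaw (S : LTISystem n p) (σ : ℝ) {N : ℕ}
    (π : Algorithm n p N) (t : ℕ) (h : t ≤ N) : IsProbabilityMeasure (S.historyLaw σ π t h) := by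
  induction t with
  | zero => rw [historyLaw]; infer_instance
  | succ t ih =>
    have := ih (Nat.le_of_succ_le h)
    have := π.markov ⟨t, h⟩
    rw [historyLaw]
    exact Measure.isProbabilityMeasure_map S.measurable_extend.aemeasurable

/-- The law of the input `u_s` is the same in all histories that contain it. -/
lemma lintegral_input_historyLaw (S : LTISystem n p) (σ : ℝ) {N : ℕ} (π : Algorithm n p N)
    {f : Vec p → ℝ≥0∞} (hf : Measurable f) {s : ℕ} (hs : s < N) (t : ℕ) (ht : t ≤ N)
    (hst : s < t) :
    ∫⁻ h, f (h.1 ⟨s, hst⟩) ∂(S.historyLaw σ π t ht) =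
      ∫⁻ z, f z.2 ∂(S.historyLaw σ π s hs.le ⊗ₘ π.policy ⟨s, hs⟩) := by
  induction t with
  | zero => omega
  | succ t ih =>
    have := π.markov ⟨t, ht⟩
    have hm : Measurable fun h : History n p (t + 1) => f (h.1 ⟨s, hst⟩) := by fun_prop
    rw [historyLaw, lintegral_map hm S.measurable_extend]
    -- An older input survives the extension, so the new input and noise integrate out; for the
    -- newest input only the noise does.
    rcases Nat.lt_succ_iff_lt_or_eq.1 hst with hlt | rfl
    · rw [← ih (Nat.le_of_succ_le ht) hlt]
      have he : ∀ z : (History n p t × Vec p) × Vec n,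
          (S.extend z).1 ⟨s, hst⟩ = z.1.1.1 ⟨s, hlt⟩ := fun z => by
        change (Fin.snoc (α := fun _ => Vec p) z.1.1.1 z.1.2 : Fin (t + 1) → Vec p)
          (Fin.castSucc ⟨s, hlt⟩) = _
        rw [Fin.snoc_castSucc]
      simp_rw [he]
      rw [lintegral_prod _ (by fun_prop)]
      simp only [lintegral_const, measure_univ, mul_one]
      rw [Measure.lintegral_compProd (by fun_prop)]
      simp
    · have he : ∀ z : (History n p s × Vec p) × Vec n,
          (S.extend z).1 ⟨s, hst⟩ = z.1.2 := fun z => by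
        change (Fin.snoc (α := fun _ => Vec p) z.1.1.1 z.1.2 : Fin (s + 1) → Vec p)
          (Fin.last s) = _
        rw [Fin.snoc_last]
      simp_rw [he]
      rw [lintegral_prod _ (by fun_prop)]
      simp

end LTISystem

/-! ### One step of the chain systems -/

/-- Changing the first entry of the input matrix amounts to shifting the first noise coordinate. -/
lemma next_chainSystem {n : ℕ} (hn : 2 ≤ n) (r v m : ℝ) (x : Vec n) (u : Vec 1) (w : Vec n) :
    (chainSystem n r v m).next x u w = (chainSystem n r v 0).next x u
      ((m * u 0) • EuclideanSpace.single (⟨0, by omega⟩ : Fin n) (1 : ℝ) + w) := by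
  ext i
  simp only [LTISystem.next, chainSystem, PiLp.add_apply, Matrix.toLpLin_apply, PiLp.smul_apply,
    Matrix.mulVec, dotProduct, Fin.sum_univ_one, Matrix.of_apply, PiLp.single_apply,
    Fin.ext_iff, smul_eq_mul]
  by_cases hi : i.val = 0
  · simp [hi]; ring
  · simp [hi]

lemma extend_chainSystem {n : ℕ} (hn : 2 ≤ n) (r v m : ℝ) {t : ℕ} (y : History n 1 t × Vec 1)
    (w : Vec n) :
    (chainSystem n r v m).extend (y, w) = (chainSystem n r v 0).extend
      (y, (m * y.2 0) • EuclideanSpace.single (⟨0, by omega⟩ : Fin n) (1 : ℝ) + w) := by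
  simp only [LTISystem.extend, next_chainSystem hn r v m]

/-- One step of the system, with the noise split into the first coordinate, which carries the
dependence on the input through `m`, and an independent remainder. -/
lemma map_extend_chainSystem {n : ℕ} (hn : 2 ≤ n) (r v m σ : ℝ) {t : ℕ}
    (ρ : Measure (History n 1 t × Vec 1)) [IsProbabilityMeasure ρ] :
    (ρ.prod (LTISystem.noise n σ)).map (chainSystem n r v m).extend =
      ((ρ ⊗ₘ gaussianKernel (fun y => m * y.2 0) (by fun_prop) (σ ^ 2).toNNReal).prod
        (residualNoise (⟨0, by omega⟩ : Fin n) σ)).map fun q => (chainSystem n r v 0).extend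
          (q.1.1, q.1.2 • EuclideanSpace.single (⟨0, by omega⟩ : Fin n) (1 : ℝ) + q.2) := by
  have h0 := (chainSystem n r v 0).measurable_extend (t := t)
  have hm := (chainSystem n r v m).measurable_extend (t := t)
  have hG : Measurable fun q : ((History n 1 t × Vec 1) × ℝ) × Vec n =>
      (chainSystem n r v 0).extend
        (q.1.1, q.1.2 • EuclideanSpace.single (⟨0, by omega⟩ : Fin n) (1 : ℝ) + q.2) :=
    h0.comp (by fun_prop)
  refine Measure.ext_of_lintegral _ fun f hf => ?_
  have hfm : Measurable fun q => f ((chainSystem n r v m).extend q) := hf.comp hm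
  have hfG : Measurable fun q : ((History n 1 t × Vec 1) × ℝ) × Vec n =>
      f ((chainSystem n r v 0).extend
        (q.1.1, q.1.2 • EuclideanSpace.single (⟨0, by omega⟩ : Fin n) (1 : ℝ) + q.2)) :=
    hf.comp hG
  rw [lintegral_map hf hm, lintegral_map hf hG, lintegral_prod _ hfm.aemeasurable,
    lintegral_prod _ hfG.aemeasurable,
    Measure.lintegral_compProd (Measurable.lintegral_prod_right' hfG)]
  congr 1
  ext y
  have hk : Measurable fun w : Vec n => f ((chainSystem n r v 0).extend (y, w)) :=
    hf.comp (h0.comp (by fun_prop))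
  simp_rw [extend_chainSystem hn r v m]
  -- The Gaussian with mean `m u` is the centred one translated by `m u`, which matches the shift of
  -- the noise.
  rw [noise_eq_map_prod (⟨0, by omega⟩ : Fin n) σ,
    lintegral_map (by fun_prop) (by fun_prop), lintegral_prod _ (by fun_prop), gaussianKernel_apply,
    ← zero_add (m * y.2 0), ← gaussianReal_map_add_const, zero_add,
    lintegral_map (Measurable.lintegral_prod_right' (f := fun q : ℝ × Vec n =>
      f ((chainSystem n r v 0).extend
        (y, q.1 • EuclideanSpace.single (⟨0, by omega⟩ : Fin n) (1 : ℝ) + q.2)))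
      (hk.comp (by fun_prop))) (by fun_prop)]
  congr 1
  ext g
  congr 1
  ext w
  congr 3
  rw [add_smul]
  abel

/-! ### Induction on time -/

/-- The divergence between the laws of the histories grows by at most `m² σu² / (2 σ²)` per step. -/
lemma klDiv_historyLaw_chainSystem_le {n : ℕ} (hn : 2 ≤ n) (r v m : ℝ) {σ σu : ℝ} (hσ : 0 < σ)
    {N : ℕ} (π : Algorithm n 1 N) (hπ : (chainSystem n r v 0).InputBound σ π σu)
    (t : ℕ) (ht : t ≤ N) :
    klDiv ((chainSystem n r v 0).historyLaw σ π t ht) ((chainSystem n r v m).historyLaw σ π t ht) ≤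
      ENNReal.ofReal (t * m ^ 2 * σu ^ 2 / (2 * σ ^ 2)) := by
  induction t with
  | zero =>
    rw [LTISystem.historyLaw, LTISystem.historyLaw, klDiv_self]
    exact zero_le
  | succ t ih =>
    have := π.markov ⟨t, ht⟩
    have hs : (σ ^ 2).toNNReal ≠ 0 := by
      rw [ne_eq, Real.toNNReal_eq_zero, not_le]; positivity
    have hs' : (((σ ^ 2).toNNReal : ℝ≥0) : ℝ) = σ ^ 2 := Real.coe_toNNReal _ (sq_nonneg σ)
    -- The input bound concerns the full trajectory; it is carried back to the law at time `t`.
    have hbound : ∫⁻ z, ‖z.2‖ₑ ^ 2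
        ∂((chainSystem n r v 0).historyLaw σ π t (Nat.le_of_succ_le ht) ⊗ₘ π.policy ⟨t, ht⟩) ≤
        ENNReal.ofReal (σu ^ 2) := by
      rw [← (chainSystem n r v 0).lintegral_input_historyLaw σ π (f := fun u => ‖u‖ₑ ^ 2)
        (by fun_prop) ht N le_rfl ht]
      have h := hπ ⟨t, ht⟩
      rwa [LTISystem.trajectoryLaw, lintegral_map (by fun_prop) (by
        unfold Fin.tail; fun_prop)] at h
    have hconst : gaussianKernel (fun y : History n 1 t × Vec 1 => (0 : ℝ) * y.2 0) (by fun_prop)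
        (σ ^ 2).toNNReal = Kernel.const _ (gaussianReal 0 (σ ^ 2).toNNReal) := by
      ext1 y
      rw [gaussianKernel_apply, zero_mul, Kernel.const_apply]
    rw [LTISystem.historyLaw, LTISystem.historyLaw, map_extend_chainSystem hn r v 0,
      map_extend_chainSystem hn r v m]
    refine (klDiv_map_le _ _ ((chainSystem n r v 0).measurable_extend.comp (by fun_prop))).trans ?_
    -- The chain rule leaves the histories followed by a common policy, which cancels, plus a
    -- Gaussian term averaged under the system with `b = 0`.
    rw [klDiv_prod_left, klDiv_compProd_eq_add, klDiv_compProd_left, hconst]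
    refine (add_le_add (ih (Nat.le_of_succ_le ht))
      (klDiv_compProd_gaussianKernel_le _ _ _ hs)).trans ?_
    have hstep : ∫⁻ z, ENNReal.ofReal ((m * z.2 0) ^ 2 / (2 * (σ ^ 2).toNNReal))
        ∂((chainSystem n r v 0).historyLaw σ π t (Nat.le_of_succ_le ht) ⊗ₘ π.policy ⟨t, ht⟩) ≤
        ENNReal.ofReal (m ^ 2 / (2 * σ ^ 2) * σu ^ 2) := by
      have he : ∀ z : History n 1 t × Vec 1,
          ENNReal.ofReal ((m * z.2 0) ^ 2 / (2 * (σ ^ 2).toNNReal)) =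
            ENNReal.ofReal (m ^ 2 / (2 * σ ^ 2)) * ‖z.2‖ₑ ^ 2 := fun z => by
        rw [hs', ← ofReal_norm, ← ENNReal.ofReal_pow (norm_nonneg _),
          ← ENNReal.ofReal_mul (by positivity), EuclideanSpace.real_norm_sq_eq, Fin.sum_univ_one]
        congr 1
        ring
      simp_rw [he]
      rw [lintegral_const_mul _ (by fun_prop), ENNReal.ofReal_mul (by positivity)]
      gcongr
    refine (add_le_add le_rfl hstep).trans ?_
    rw [← ENNReal.ofReal_add (by positivity) (by positivity)]
    refine ENNReal.ofReal_le_ofReal (le_of_eq ?_)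
    push_cast
    ring

end LearnStab

theorem proposition2 (n : ℕ) (hn : 2 ≤ n) (r v m : ℝ) (hr : 1 < r) (hv : 0 < v)
    (hvr : v < (r - 1) / 2) (hm : 0 ≤ m) (σw σu : ℝ) (hσw : 0 < σw) (hσu : 0 < σu)
    (N : ℕ) (π : LearnStab.Algorithm n 1 N)
    (hπ : (LearnStab.chainSystem n r v 0).InputBound σw π σu) :
    klDiv ((LearnStab.chainSystem n r v 0).trajectoryLaw σw π)
        ((LearnStab.chainSystem n r v m).trajectoryLaw σw π) ≤
      ENNReal.ofReal (N * m ^ 2 * σu ^ 2 / (2 * σw ^ 2)) :=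
  -- The trajectory is the history with `x_0` forgotten, so data processing applies.
  (klDiv_map_le _ _ (by unfold Fin.tail; fun_prop)).trans
    (LearnStab.klDiv_historyLaw_chainSystem_le hn r v m hσw π hπ N le_rfl)
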